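/- Let $2 \le k < n$ and $\lambda > 0$. An $(n,k)$ batch mix is a system of $n$ first-in first-out queues with infinite buffers, each receiving messages from an independent Poisson process of rate $\lambda$; messages are blocked as long as fewer than $k$ queues are non-empty, and as soon as $k$ queues become non-empty, one message from each of them is dispatched instantly. Hence at most $k-1$ queues are non-empty at any time, and the state of the mix is the continuous-time Markov process $L(t) = (l_1(t), \dots, l_{k-1}(t))$, where $l_i(t)$ is the length of the $i$-th longest queue at time $t$; its state space is $\{ l \in \mathbb{Z}_{\ge 0}^{k-1} : l_1 \ge \dots \ge l_{k-1} \}$. Then the mix is stable: the process $L(t)$ has an invariant probability measure, that is, a probability measure $\pi$ such that $L(0) \sim \pi$ (independently of the arrivals) implies $L(t) \sim \pi$ for all $t \ge 0$. Moreover, $L(t)$ is positive recurrent: for every state $l$, the process started at $l$ has a finite mean time until its first return to $l$ after leaving it. -/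

import Mathlib

open MeasureTheory ProbabilityTheory
open scoped ENNReal

noncomputable section

namespace BatchMix

/-! ### The queues

The content of the `n` queues is recorded by the vector `x : Fin n → ℕ` of their lengths. -/

/-- The dispatching rule of an `(n, k)` batch mix: nothing happens while fewer than `k` queues are
non-empty; as soon as `k` queues are non-empty, one message leaves each of them. -/
def dispatch {n : ℕ} (k : ℕ) (x : Fin n → ℕ) : Fin n → ℕ :=
  if k ≤ (Finset.univ.filter fun j => 0 < x j).card then fun j => x j - 1 else x

/-- The queue lengths after the arrival of one message of sender `i`, including the batch departure
that this arrival may trigger. -/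
def arrive {n : ℕ} (k : ℕ) (x : Fin n → ℕ) (i : Fin n) : Fin n → ℕ :=
  dispatch k (Function.update x i (x i + 1))

/-! ### The state: sorted lengths of the `k - 1` longest queues -/

/-- States `(l₁ ≥ l₂ ≥ ⋯ ≥ l_{k-1})`. -/
abbrev State (k : ℕ) : Type := {l : Fin (k - 1) → ℕ // Antitone l}

/-- The queue lengths in non-increasing order. -/
def sortedLengths {n : ℕ} (x : Fin n → ℕ) : Fin n → ℕ :=
  x ∘ Tuple.sort (OrderDual.toDual ∘ x)

theorem antitone_sortedLengths {n : ℕ} (x : Fin n → ℕ) : Antitone (sortedLengths x) := by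
  intro i j hij
  exact OrderDual.toDual_le_toDual.mp (Tuple.monotone_sort (OrderDual.toDual ∘ x) hij)

/-- The sorted lengths of the `k - 1` longest queues (padded with zeros should there be fewer than
`k - 1` queues). -/
def longest {n : ℕ} (k : ℕ) (x : Fin n → ℕ) : State k :=
  ⟨fun i => if h : (i : ℕ) < n then sortedLengths x ⟨i, h⟩ else 0, by
    intro i j hij
    dsimp only
    split_ifs with hj hi
    · exact antitone_sortedLengths x (Fin.mk_le_mk.mpr hij)
    · exact absurd (lt_of_le_of_lt (Fin.le_def.mp hij) hj) hi
    · exact Nat.zero_le _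
    · exact Nat.zero_le _⟩

/-- The queue lengths in a system of `n` queues whose state is `l`: the first `k - 1` queues hold
`l₁, …, l_{k-1}` messages and the others are empty. (At most `k - 1` queues are non-empty, and the
senders are interchangeable, so that this is no loss of generality.) -/
def queues (n : ℕ) {k : ℕ} (l : State k) : Fin n → ℕ :=
  fun j => if h : (j : ℕ) < k - 1 then l.1 ⟨j, h⟩ else 0

/-- The new state when a message of sender `i` arrives in state `l`. -/
def step {n k : ℕ} (l : State k) (i : Fin n) : State k :=
  longest k (arrive k (queues n l) i)

/-! ### The continuous-time Markov process

In every state each of the `n` senders independently produces messages at rate `lam`, so that the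
process jumps from `l` to `l'` at rate `lam * #{i | step l i = l'}`. It is built from its jump chain
and holding times: the total rate is `n * lam` in every state, and the message that arrives when the
holding time is over comes from each sender with the same probability `1 / n`, independently of
everything else. Equivalently: the superposition of the `n` independent Poisson processes of rate
`lam`, each arrival marked by its sender. -/

/-- Sample points: the times between successive arrivals to the mix, and the senders of the
successive messages. -/
abbrev Path (n : ℕ) : Type := (ℕ → ℝ) × (ℕ → Fin n)

/-- The times between arrivals are independent and exponential of rate `n * lam`; the senders are
independent, uniform, and independent of the times. -/
def pathMeasure (n : ℕ) (lam : ℝ) : Measure (Path n) :=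
  (Measure.infinitePi fun _ : ℕ => expMeasure (n * lam)).prod
    (Measure.infinitePi fun _ : ℕ => uniformOn (Set.univ : Set (Fin n)))

/-- The time of the `m`-th arrival to the mix, with `epoch ω 0 = 0`. -/
def epoch {n : ℕ} (ω : Path n) (m : ℕ) : ℝ := ∑ j ∈ Finset.range m, ω.1 j

/-- The number of arrivals to the mix up to time `t`. -/
def numArrivals {n : ℕ} (ω : Path n) (t : ℝ) : ℕ := {m : ℕ | epoch ω (m + 1) ≤ t}.ncard

/-- The embedded jump chain: the state just after the `m`-th arrival, from the initial state `l`. -/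
def jumpChain {n k : ℕ} (l : State k) (ω : Path n) : ℕ → State k
  | 0 => l
  | m + 1 => step (jumpChain l ω m) (ω.2 m)

/-- The state process `L(t)` with `L(0) = l`. -/
def stateProcess {n k : ℕ} (l : State k) (t : ℝ) (ω : Path n) : State k :=
  jumpChain l ω (numArrivals ω t)

/-- `π` is invariant for the state process: if the initial state has law `π` and is independent of
the arrivals, then the state has law `π` at every time `t ≥ 0`. -/
def IsInvariant (n k : ℕ) (lam : ℝ) (π : Measure (State k)) : Prop :=
  ∀ t : ℝ, 0 ≤ t →
    (π.prod (pathMeasure n lam)).map (fun p => stateProcess p.1 t p.2) = π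

/-- Stability: the state process has an invariant probability measure. -/
def IsStable (n k : ℕ) (lam : ℝ) : Prop :=
  ∃ π : Measure (State k), IsProbabilityMeasure π ∧ IsInvariant n k lam π

/-- The first time, after the process has left its initial state `l`, at which it is in `l` again
(`∞` if there is none). -/
def returnTime {n k : ℕ} (l : State k) (ω : Path n) : ℝ≥0∞ :=
  ⨅ (t : ℝ) (_ : epoch ω 1 ≤ t ∧ stateProcess l t ω = l), ENNReal.ofReal t

/-- Positive recurrence: the mean return time of every state is finite. -/
def IsPositiveRecurrent (n k : ℕ) (lam : ℝ) : Prop :=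
  ∀ l : State k, ∫⁻ ω, returnTime l ω ∂(pathMeasure n lam) < ∞

end BatchMix

end

noncomputable section

namespace BatchMix

/-! The total arrival rate is nλ in every state, so L is a discrete chain, driven by independent
uniform senders, run on an independent clock. Both claims reduce to `summable_avoidProb`: the
probabilities that the chain has not visited a given state by time m are summable in m.

This follows from Foster's criterion with V = k∑xⱼ² - (∑xⱼ)². Cauchy–Schwarz gives V ≥ 0, as at most
k-1 queues are non-empty. As a form in k coordinates V is invariant under subtracting 1 from all of
them, so a batch departure leaves V unchanged. Hence every arrival at queue i, with or without
dispatch, changes V by 2k·xᵢ - 2T + k - 1, where T = ∑xⱼ (`energy_arrive`). Averaging over i gives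
the drift -2(n-k)T/n + k - 1, at most -1 outside a finite set because k < n. All states communicate
(`transGen_leads`), so a bound for a finite set becomes one for a single state
(`exists_sum_avoidProb_le`).

The mean return time is then at most the mean holding time times that sum, by independence. The
expected visit counts during an excursion form a finite measure, which normalises to an invariant
law of the chain; independence of the clock makes it invariant for L. -/

/-- The number of non-empty queues. -/
def numBusy {n : ℕ} (x : Fin n → ℕ) : ℕ := (Finset.univ.filter fun j => 0 < x j).card

/-! ### Sums over sorted states and over queue vectors -/

theorem sortedLengths_eq_zero {n k : ℕ} {x : Fin n → ℕ} (hx : numBusy x ≤ k - 1) (j : Fin n)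
    (hj : k - 1 ≤ j) : sortedLengths x j = 0 := by
  by_contra h
  have h1 : (Finset.univ.filter fun i => 0 < sortedLengths x i).card = numBusy x := by
    refine Finset.card_equiv (Tuple.sort (OrderDual.toDual ∘ x)) fun i => ?_
    simp only [Finset.mem_filter, Finset.mem_univ, true_and]
    rfl
  have h2 : Finset.Iic j ⊆ Finset.univ.filter fun i => 0 < sortedLengths x i := by
    intro i hi
    have := antitone_sortedLengths x (Finset.mem_Iic.mp hi)
    simp only [Finset.mem_filter, Finset.mem_univ, true_and]
    omega
  have h3 := Finset.card_le_card h2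
  rw [h1, Fin.card_Iic] at h3
  omega

theorem sum_fin_eq_of_eq_zero {M : Type*} [AddCommMonoid M] {m n : ℕ} (h : m ≤ n) (g : ℕ → M)
    (hg : ∀ j, m ≤ j → j < n → g j = 0) : ∑ i : Fin m, g i = ∑ j : Fin n, g j := by
  rw [Fin.sum_univ_eq_sum_range, Fin.sum_univ_eq_sum_range]
  refine Finset.sum_subset (Finset.range_mono h) fun j hj hj' => hg j ?_ ?_ <;> simp_all

/-- Sorting only permutes the summands, and the entries cut off by `longest` are zero; hence the
condition `f 0 = 0`. -/
theorem sum_longest {M : Type*} [AddCommMonoid M] {n k : ℕ} (hkn : k - 1 ≤ n) {x : Fin n → ℕ}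
    (hx : numBusy x ≤ k - 1) (f : ℕ → M) (hf : f 0 = 0) :
    ∑ i, f ((longest k x).1 i) = ∑ j, f (x j) := by
  have h := sum_fin_eq_of_eq_zero hkn
    (fun j => f (if h : j < n then sortedLengths x ⟨j, h⟩ else 0)) (fun j h1 h2 => by
      simp only [h2, dite_true]
      rw [sortedLengths_eq_zero hx ⟨j, h2⟩ h1, hf])
  refine h.trans ?_
  simp only [Fin.is_lt, dite_true, Fin.eta]
  exact Equiv.sum_comp (Tuple.sort (OrderDual.toDual ∘ x)) fun j => f (x j)

theorem sum_queues {M : Type*} [AddCommMonoid M] {n k : ℕ} (hkn : k - 1 ≤ n) (l : State k)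
    (f : ℕ → M) (hf : f 0 = 0) : ∑ j, f (queues n l j) = ∑ i, f (l.1 i) := by
  have h := sum_fin_eq_of_eq_zero hkn
    (fun j => f (if h : j < k - 1 then l.1 ⟨j, h⟩ else 0)) (fun j h1 h2 => by
      simp [not_lt.mpr h1, hf])
  refine h.symm.trans ?_
  simp

theorem numBusy_eq_sum {n : ℕ} (x : Fin n → ℕ) : numBusy x = ∑ j, if 0 < x j then 1 else 0 := by
  rw [numBusy, Finset.card_filter]

theorem numBusy_queues_le {n k : ℕ} (hkn : k - 1 ≤ n) (l : State k) :
    numBusy (queues n l) ≤ k - 1 := by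
  rw [numBusy_eq_sum, sum_queues hkn l (fun m => if 0 < m then 1 else 0) (by simp),
    ← Finset.card_filter]
  exact (Finset.card_le_univ _).trans (by simp)

theorem sum_update {M : Type*} [AddCommGroup M] {n : ℕ} (x : Fin n → ℕ) (i : Fin n) (a : ℕ)
    (f : ℕ → M) : ∑ j, f (Function.update x i a j) = ∑ j, f (x j) - f (x i) + f a := by
  rw [← Finset.add_sum_erase _ _ (Finset.mem_univ i),
    ← Finset.add_sum_erase _ (fun j => f (x j)) (Finset.mem_univ i),
    Finset.sum_congr rfl fun j hj => by
      rw [Function.update_of_ne (Finset.ne_of_mem_erase hj)]]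
  simp only [Function.update_self]
  abel

/-! ### The effect of one arrival -/

theorem numBusy_update {n : ℕ} (x : Fin n → ℕ) (i : Fin n) :
    numBusy (Function.update x i (x i + 1)) = numBusy x + if x i = 0 then 1 else 0 := by
  have h := sum_update x i (x i + 1) fun m => if 0 < m then (1 : ℤ) else 0
  have h1 : (numBusy (Function.update x i (x i + 1)) : ℤ) =
      numBusy x - (if 0 < x i then 1 else 0) + 1 := by
    rw [numBusy_eq_sum, numBusy_eq_sum]
    push_cast
    simpa using h
  split_ifs at h1 ⊢ <;> omega

theorem arrive_of_busy {n k : ℕ} {x : Fin n → ℕ} (hx : numBusy x ≤ k - 1) (hk : 1 ≤ k) {i : Fin n}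
    (hi : x i ≠ 0) : arrive k x i = Function.update x i (x i + 1) := by
  have h := numBusy_update x i
  rw [if_neg hi] at h
  rw [arrive, dispatch, if_neg]
  change ¬ k ≤ numBusy _
  omega

theorem arrive_of_lt {n k : ℕ} {x : Fin n → ℕ} (hx : numBusy x < k - 1) (i : Fin n) :
    arrive k x i = Function.update x i (x i + 1) := by
  have h := numBusy_update x i
  rw [arrive, dispatch, if_neg]
  change ¬ k ≤ numBusy _
  split_ifs at h <;> omega

theorem arrive_of_full {n k : ℕ} {x : Fin n → ℕ} (hx : numBusy x = k - 1) {i : Fin n}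
    (hi : x i = 0) : arrive k x i = fun j => x j - 1 := by
  have h := numBusy_update x i
  rw [if_pos hi] at h
  rw [arrive, dispatch, if_pos]
  · funext j
    by_cases hj : j = i
    · subst hj; simp [hi]
    · simp [Function.update_of_ne hj]
  · change k ≤ numBusy _
    omega

theorem numBusy_arrive_le {n k : ℕ} (hk : 1 ≤ k) {x : Fin n → ℕ} (hx : numBusy x ≤ k - 1)
    (i : Fin n) : numBusy (arrive k x i) ≤ k - 1 := by
  have h := numBusy_update x i
  by_cases hi : x i = 0
  · rcases hx.lt_or_eq with hx' | hx'
    · rw [arrive_of_lt hx', h]; split_ifs; omega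
    · rw [arrive_of_full hx' hi, ← hx']
      refine Finset.card_le_card fun j hj => ?_
      simp only [Finset.mem_filter, Finset.mem_univ, true_and] at hj ⊢
      omega
  · rw [arrive_of_busy hx hk hi, h, if_neg hi]; omega

/-! ### A quadratic Lyapunov function -/

/-- The total number of messages. -/
def total {m : ℕ} (x : Fin m → ℕ) : ℤ := ∑ j, (x j : ℤ)

/-- The sum of the squared queue lengths. -/
def sumSq {m : ℕ} (x : Fin m → ℕ) : ℤ := ∑ j, (x j : ℤ) ^ 2

/-- The Lyapunov function `k ∑ xⱼ² - (∑ xⱼ)²`. -/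
def energy {m : ℕ} (k : ℕ) (x : Fin m → ℕ) : ℤ := k * sumSq x - total x ^ 2

theorem energy_nonneg {k : ℕ} (l : State k) : 0 ≤ energy k l.1 := by
  have h := sq_sum_le_card_mul_sum_sq (s := Finset.univ) (f := fun i => (l.1 i : ℤ))
  have h2 : 0 ≤ sumSq l.1 := Finset.sum_nonneg fun i _ => sq_nonneg _
  simp only [Finset.card_univ, Fintype.card_fin] at h
  have h3 : ((k - 1 : ℕ) : ℤ) ≤ k := by omega
  have := mul_le_mul_of_nonneg_right h3 h2
  unfold energy total
  unfold sumSq at *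
  linarith

theorem total_update {n : ℕ} (x : Fin n → ℕ) (i : Fin n) :
    total (Function.update x i (x i + 1)) = total x + 1 := by
  rw [total, sum_update x i _ fun m => (m : ℤ), total]; push_cast; ring

theorem sumSq_update {n : ℕ} (x : Fin n → ℕ) (i : Fin n) :
    sumSq (Function.update x i (x i + 1)) = sumSq x + 2 * x i + 1 := by
  rw [sumSq, sum_update x i _ fun m => (m : ℤ) ^ 2, sumSq]; push_cast; ring

theorem total_sub_one {n : ℕ} (x : Fin n → ℕ) :
    total (fun j => x j - 1) = total x - numBusy x := by
  rw [numBusy_eq_sum, total, total]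
  push_cast
  rw [← Finset.sum_sub_distrib]
  refine Finset.sum_congr rfl fun j _ => ?_
  split_ifs <;> omega

theorem sumSq_sub_one {n : ℕ} (x : Fin n → ℕ) :
    sumSq (fun j => x j - 1) = sumSq x - 2 * total x + numBusy x := by
  rw [numBusy_eq_sum, total, sumSq, sumSq]
  push_cast
  rw [Finset.mul_sum, ← Finset.sum_sub_distrib, ← Finset.sum_add_distrib]
  refine Finset.sum_congr rfl fun j _ => ?_
  rcases Nat.eq_zero_or_pos (x j) with h | h
  · simp [h]
  · rw [if_pos h]; push_cast [h]; ring

theorem total_longest {n k : ℕ} (hkn : k - 1 ≤ n) {x : Fin n → ℕ} (hx : numBusy x ≤ k - 1) :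
    total (longest k x).1 = total x :=
  sum_longest hkn hx (fun m => (m : ℤ)) (by simp)

theorem energy_longest {n k : ℕ} (hkn : k - 1 ≤ n) {x : Fin n → ℕ} (hx : numBusy x ≤ k - 1) :
    energy k (longest k x).1 = energy k x := by
  rw [energy, energy, total_longest hkn hx]
  congr 2
  exact sum_longest hkn hx (fun m => (m : ℤ) ^ 2) (by simp)

theorem total_queues {n k : ℕ} (hkn : k - 1 ≤ n) (l : State k) :
    total (queues n l) = total l.1 :=
  sum_queues hkn l (fun m => (m : ℤ)) (by simp)

theorem energy_queues {n k : ℕ} (hkn : k - 1 ≤ n) (l : State k) :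
    energy k (queues n l) = energy k l.1 := by
  rw [energy, energy, total_queues hkn]
  congr 2
  exact sum_queues hkn l (fun m => (m : ℤ) ^ 2) (by simp)

/-- The formula is the same with and without a dispatch: V does not see a batch departure. It is
affine in `x i`, so its sum over the senders involves only `energy` and `total`. -/
theorem energy_arrive {n k : ℕ} (hk : 1 ≤ k) {x : Fin n → ℕ} (hx : numBusy x ≤ k - 1)
    (i : Fin n) :
    energy k (arrive k x i) = 2 * k * (x i : ℤ) + (energy k x - 2 * total x + (k - 1)) := by
  rcases hx.lt_or_eq with hx' | hx'
  · rw [arrive_of_lt hx', energy, total_update, sumSq_update, energy]; ring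
  · have hq : (numBusy x : ℤ) = k - 1 := by omega
    by_cases hi : x i = 0
    · rw [arrive_of_full hx' hi, energy, total_sub_one, sumSq_sub_one, energy, hq, hi]
      push_cast
      ring
    · rw [arrive_of_busy hx hk hi, energy, total_update, sumSq_update, energy]; ring

theorem sum_energy_arrive {n k : ℕ} (hk : 1 ≤ k) {x : Fin n → ℕ} (hx : numBusy x ≤ k - 1) :
    ∑ i, energy k (arrive k x i) =
      n * energy k x - 2 * (n - k) * total x + n * (k - 1) := by
  rw [Finset.sum_congr rfl fun i _ => energy_arrive hk hx i, Finset.sum_add_distrib,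
    ← Finset.mul_sum]
  change 2 * (k : ℤ) * total x + _ = _
  simp only [Finset.sum_const, Finset.card_univ, Fintype.card_fin, nsmul_eq_mul]
  ring

theorem sum_energy_step {n k : ℕ} (hk : 1 ≤ k) (hkn : k - 1 ≤ n) (l : State k) :
    ∑ i : Fin n, energy k (step l i).1 =
      n * energy k l.1 - 2 * (n - k) * total l.1 + n * (k - 1) := by
  have hq := numBusy_queues_le hkn l
  rw [← energy_queues hkn l, ← total_queues hkn l, ← sum_energy_arrive hk hq]
  exact Finset.sum_congr rfl fun i _ => energy_longest hkn (numBusy_arrive_le hk hq i)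

theorem finite_setOf_total_le (k : ℕ) (B : ℤ) : {l : State k | total l.1 ≤ B}.Finite := by
  refine ((Set.finite_Iic (fun _ : Fin (k - 1) => B.toNat)).preimage
    Subtype.val_injective.injOn).subset fun l hl i => ?_
  have h : (l.1 i : ℤ) ≤ total l.1 :=
    Finset.single_le_sum (f := fun i => (l.1 i : ℤ)) (fun j _ => by positivity) (Finset.mem_univ i)
  have h2 : total l.1 ≤ B := hl
  change l.1 i ≤ B.toNat
  omega

/-! ### Irreducibility -/

theorem antitone_queues (n : ℕ) {k : ℕ} (l : State k) : Antitone (queues n l) := by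
  intro i j hij
  unfold queues
  have hij' : (i : ℕ) ≤ j := hij
  split_ifs with hj hi
  · exact l.2 (Fin.mk_le_mk.mpr hij')
  · omega
  · exact Nat.zero_le _
  · exact le_rfl

theorem longest_queues {n k : ℕ} (hkn : k - 1 ≤ n) (l : State k) :
    longest k (queues n l) = l := by
  have h : Tuple.sort (OrderDual.toDual ∘ queues n l) = Equiv.refl _ :=
    Tuple.sort_eq_refl_iff_monotone.mpr fun i j hij => antitone_queues n l hij
  refine Subtype.ext (funext fun i => ?_)
  have hi : (i : ℕ) < n := i.2.trans_le hkn
  simp [longest, sortedLengths, h, queues, hi]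

theorem numBusy_queues_longest {n k : ℕ} (hkn : k - 1 ≤ n) {x : Fin n → ℕ}
    (hx : numBusy x ≤ k - 1) : numBusy (queues n (longest k x)) = numBusy x := by
  rw [numBusy_eq_sum, numBusy_eq_sum,
    sum_queues hkn (longest k x) (fun m => if 0 < m then 1 else 0) (by simp),
    sum_longest hkn hx (fun m => if 0 < m then 1 else 0) (by simp)]

/-- One arrival leads from `l` to `l'`. -/
def Leads (n : ℕ) {k : ℕ} (l l' : State k) : Prop := ∃ i : Fin n, step l i = l'

/-- Queue `k - 1` (counted from 0) is empty in every sorted state. Feeding it `j` times, with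
re-sorting in between, makes `k - 1` queues busy; one more arrival there triggers a batch that
removes that message and `k - 1` older ones. -/
theorem exists_total_lt {n k : ℕ} (hk : 1 ≤ k) (hkn : k ≤ n) (j : ℕ) (l : State k)
    (hl : numBusy (queues n l) + j = k - 1) :
    ∃ l' : State k, Relation.ReflTransGen (Leads n) l l' ∧
      total l'.1 = total l.1 + j - (k - 1) := by
  have hkn' : k - 1 ≤ n := by omega
  have hi : queues n l ⟨k - 1, by omega⟩ = 0 := by simp [queues]
  have hq := numBusy_queues_le hkn' l
  induction j generalizing l with
  | zero =>
    refine ⟨step l ⟨k - 1, by omega⟩, Relation.ReflTransGen.single ⟨_, rfl⟩, ?_⟩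
    rw [step, total_longest hkn' (numBusy_arrive_le hk hq _), arrive_of_full (by omega) hi,
      total_sub_one, total_queues hkn']
    omega
  | succ j ih =>
    have hb := numBusy_update (queues n l) ⟨k - 1, by omega⟩
    rw [if_pos hi, ← arrive_of_lt (k := k) (by omega : numBusy (queues n l) < k - 1),
      ← numBusy_queues_longest hkn' (numBusy_arrive_le hk hq _)] at hb
    obtain ⟨l', h1, h2⟩ := ih (step l (⟨k - 1, by omega⟩ : Fin n))
      (by rw [step]; omega)
      (by simp [queues]) (numBusy_queues_le hkn' _)
    refine ⟨l', Relation.ReflTransGen.head ⟨_, rfl⟩ h1, ?_⟩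
    rw [h2, step, total_longest hkn' (numBusy_arrive_le hk hq _),
      arrive_of_lt (by omega : numBusy (queues n l) < k - 1),
      total_update, total_queues hkn']
    push_cast
    ring

/-- The state without messages. -/
def emptyState (k : ℕ) : State k := ⟨0, fun _ _ _ => le_rfl⟩

theorem total_nonneg {m : ℕ} (x : Fin m → ℕ) : 0 ≤ total x :=
  Finset.sum_nonneg fun _ _ => by positivity

theorem eq_emptyState_of_total_eq_zero {k : ℕ} {l : State k} (hl : total l.1 = 0) :
    l = emptyState k := by
  refine Subtype.ext (funext fun i => ?_)
  have h := (Finset.sum_eq_zero_iff_of_nonneg (fun _ _ => by positivity)).mp hl i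
    (Finset.mem_univ i)
  simpa [emptyState] using h

theorem numBusy_pos {n k : ℕ} (hkn : k - 1 ≤ n) {l : State k} (hl : total l.1 ≠ 0) :
    0 < numBusy (queues n l) := by
  rw [Nat.pos_iff_ne_zero]
  intro h
  apply hl
  rw [← total_queues hkn]
  refine Finset.sum_eq_zero fun j _ => ?_
  have := Finset.filter_eq_empty_iff.mp (Finset.card_eq_zero.mp h) (Finset.mem_univ j)
  simpa using this

theorem leads_to_emptyState {n k : ℕ} (hk : 1 ≤ k) (hkn : k ≤ n) (l : State k) :
    Relation.ReflTransGen (Leads n) l (emptyState k) := by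
  have hkn' : k - 1 ≤ n := by omega
  induction h : (total l.1).toNat using Nat.strong_induction_on generalizing l with
  | _ N ih =>
    by_cases hl : total l.1 = 0
    · rw [eq_emptyState_of_total_eq_zero hl]
    · have hq := numBusy_queues_le hkn' l
      have hq' := numBusy_pos hkn' hl
      have h0 := total_nonneg l.1
      obtain ⟨l', h1, h2⟩ := exists_total_lt hk hkn (k - 1 - numBusy (queues n l)) l (by omega)
      exact h1.trans (ih _ (by omega) l' rfl)

/-- Remove a message from the last non-empty queue: the lengths stay sorted, and putting it back
triggers no dispatch because `l` has at most `k - 1` busy queues. -/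
theorem exists_leads_to {n k : ℕ} (hk : 1 ≤ k) (hkn : k - 1 ≤ n) {l : State k}
    (hl : total l.1 ≠ 0) : ∃ l', Leads n l' l ∧ total l.1 = total l'.1 + 1 := by
  have hne : (Finset.univ.filter fun i => 0 < l.1 i).Nonempty := by
    by_contra h
    rw [Finset.not_nonempty_iff_eq_empty, Finset.filter_eq_empty_iff] at h
    exact hl (Finset.sum_eq_zero fun i _ => by simpa using h (Finset.mem_univ i))
  obtain ⟨j, hj, hmax⟩ := Finset.exists_max_image _ id hne
  simp only [Finset.mem_filter, Finset.mem_univ, true_and, id] at hj hmax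
  have hanti : Antitone (Function.update l.1 j (l.1 j - 1)) := by
    intro a b hab
    have h1 := l.2 hab
    rcases eq_or_ne a j with rfl | ha
    · rcases eq_or_ne b a with rfl | hb
      · exact le_rfl
      · rw [Function.update_self, Function.update_of_ne hb]
        have : ¬ 0 < l.1 b := fun h => hb (le_antisymm (hmax b h) hab)
        omega
    · rw [Function.update_of_ne ha]
      rcases eq_or_ne b j with rfl | hb
      · rw [Function.update_self]; omega
      · rwa [Function.update_of_ne hb]
  let l' : State k := ⟨_, hanti⟩
  let i : Fin n := ⟨j, j.2.trans_le hkn⟩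
  have hup : Function.update (queues n l') i (queues n l' i + 1) = queues n l := by
    funext b
    rcases eq_or_ne b i with rfl | hb
    · simp [queues, l', i]; omega
    · rw [Function.update_of_ne hb]
      have : ∀ h : (b : ℕ) < k - 1, (⟨b, h⟩ : Fin (k - 1)) ≠ j := fun h h' =>
        hb (Fin.ext (by simp [i, ← h']))
      unfold queues
      split_ifs with h
      · exact Function.update_of_ne (this h) _ _
      · rfl
  have hb := numBusy_update (queues n l') i
  rw [hup] at hb
  have hq := numBusy_queues_le hkn l
  have hq' := numBusy_queues_le hkn l'
  have harr : arrive k (queues n l') i = queues n l := by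
    rw [← hup]
    by_cases h : queues n l' i = 0
    · rw [if_pos h] at hb
      exact arrive_of_lt (by omega) i
    · exact arrive_of_busy hq' hk h
  refine ⟨l', ⟨i, by rw [step, harr, longest_queues hkn]⟩, ?_⟩
  rw [← total_queues hkn l, ← hup, total_update, total_queues hkn]

theorem emptyState_leads_to {n k : ℕ} (hk : 1 ≤ k) (hkn : k - 1 ≤ n) (l : State k) :
    Relation.ReflTransGen (Leads n) (emptyState k) l := by
  induction h : (total l.1).toNat using Nat.strong_induction_on generalizing l with
  | _ N ih =>
    by_cases hl : total l.1 = 0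
    · rw [eq_emptyState_of_total_eq_zero hl]
    · obtain ⟨l', h1, h2⟩ := exists_leads_to hk hkn hl
      have h0 := total_nonneg l'.1
      exact (ih _ (by omega) l' rfl).tail h1

theorem transGen_leads {n k : ℕ} (hk : 1 ≤ k) (hkn : k ≤ n) (l l' : State k) :
    Relation.TransGen (Leads n) l l' :=
  Relation.TransGen.head' ⟨⟨0, by omega⟩, rfl⟩
    ((leads_to_emptyState hk hkn _).trans (emptyState_leads_to hk (by omega) l'))

/-! ### The Foster–Lyapunov criterion

The jump chain moves from `x` to `s x i` with `i` uniformly distributed over a finite type. -/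

section Foster

variable {α ι : Type*} [Fintype ι]

open Classical in
/-- The probability that the chain started at `x` does not visit `a` at any of the times
`1, …, m`. -/
def avoidProb (s : α → ι → α) (a : α) : ℕ → α → ℝ
  | 0, _ => 1
  | m + 1, x => (∑ i, if s x i = a then 0 else avoidProb s a m (s x i)) / Fintype.card ι

variable (s : α → ι → α) (a : α)

theorem avoidProb_nonneg (m : ℕ) (x : α) : 0 ≤ avoidProb s a m x := by
  induction m generalizing x with
  | zero => exact zero_le_one
  | succ m ih =>
    refine div_nonneg (Finset.sum_nonneg fun i _ => ?_) (Nat.cast_nonneg _)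
    split_ifs
    exacts [le_rfl, ih _]

theorem avoidProb_succ_le [Nonempty ι] (m : ℕ) (x : α) :
    avoidProb s a (m + 1) x ≤ avoidProb s a m x := by
  have hc : (0 : ℝ) < Fintype.card ι := Nat.cast_pos.mpr Fintype.card_pos
  induction m generalizing x with
  | zero =>
    simp only [avoidProb]
    rw [div_le_iff₀ hc, one_mul]
    calc _ ≤ ∑ _i : ι, (1 : ℝ) := Finset.sum_le_sum fun i _ => by
          split_ifs <;> simp
      _ = _ := by simp
  | succ m ih =>
    rw [avoidProb, avoidProb]
    gcongr with i
    split_ifs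
    exacts [le_rfl, ih _]

theorem avoidProb_antitone [Nonempty ι] (x : α) : Antitone fun m => avoidProb s a m x :=
  antitone_nat_of_succ_le fun m => avoidProb_succ_le s a m x

theorem avoidProb_le_one [Nonempty ι] (m : ℕ) (x : α) : avoidProb s a m x ≤ 1 :=
  avoidProb_antitone s a x (Nat.zero_le m)

theorem avoidProb_succ_lt_one [Nonempty ι] {m : ℕ} {x : α} (i : ι)
    (hi : s x i = a ∨ avoidProb s a m (s x i) < 1) : avoidProb s a (m + 1) x < 1 := by
  have hc : (0 : ℝ) < Fintype.card ι := Nat.cast_pos.mpr Fintype.card_pos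
  rw [avoidProb, div_lt_iff₀ hc, one_mul]
  calc _ < ∑ _i : ι, (1 : ℝ) := by
        refine Finset.sum_lt_sum (fun j _ => ?_) ⟨i, Finset.mem_univ i, ?_⟩
        · split_ifs
          exacts [zero_le_one, avoidProb_le_one s a m _]
        · split_ifs with h
          exacts [zero_lt_one, hi.resolve_left h]
    _ = _ := by simp

/-- Each step of a path to `a` has positive probability, so the finite path itself does. -/
theorem exists_avoidProb_lt_one [Nonempty ι] {x : α}
    (hx : Relation.TransGen (fun x y => ∃ i, s x i = y) x a) : ∃ m, avoidProb s a m x < 1 := by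
  induction hx using Relation.TransGen.head_induction_on with
  | single h =>
    obtain ⟨i, hi⟩ := h
    exact ⟨1, avoidProb_succ_lt_one s a i (Or.inl hi)⟩
  | head h _ ih =>
    obtain ⟨i, rfl⟩ := h
    obtain ⟨m, hm⟩ := ih
    exact ⟨m + 1, avoidProb_succ_lt_one s a i (Or.inr hm)⟩

-- Here `g` is a supersolution of the equation for the mean hitting time. Splitting off the term `m
-- = 0`, which is 1, leaves one step of the chain killed at `a`.
open Classical in
theorem sum_avoidProb_le [Nonempty ι] {g : α → ℝ} (hg0 : ∀ x, 0 ≤ g x)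
    (hg : ∀ x, 1 + (∑ i, if s x i = a then 0 else g (s x i)) / Fintype.card ι ≤ g x)
    (M : ℕ) (x : α) : ∑ m ∈ Finset.range M, avoidProb s a m x ≤ g x := by
  induction M generalizing x with
  | zero => simpa using hg0 x
  | succ M ih =>
    refine le_trans ?_ (hg x)
    rw [Finset.sum_range_succ', add_comm]
    simp only [avoidProb]
    rw [← Finset.sum_div, Finset.sum_comm]
    gcongr with i
    split_ifs with h
    · simp
    · exact ih _

theorem exists_uniform_avoidProb_le [Nonempty ι] {C : Set α} (hC : C.Finite)
    (ha : ∀ x ∈ C, Relation.TransGen (fun x y => ∃ i, s x i = y) x a) :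
    ∃ M, ∃ ε > 0, ∀ x ∈ C, avoidProb s a M x ≤ 1 - ε := by
  induction C, hC using Set.Finite.induction_on with
  | empty => exact ⟨0, 1, one_pos, by simp⟩
  | @insert y C _ _ ih =>
    obtain ⟨M, ε, hε, hM⟩ := ih fun x hx => ha x (Set.mem_insert_of_mem _ hx)
    obtain ⟨m, hm⟩ := exists_avoidProb_lt_one s a (ha y (Set.mem_insert _ _))
    refine ⟨max M m, min ε (1 - avoidProb s a m y), lt_min hε (by linarith), fun x hx => ?_⟩
    rcases hx with rfl | hx
    · have h1 := avoidProb_antitone s a x (le_max_right M m)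
      have h2 := min_le_right ε (1 - avoidProb s a m x)
      dsimp only at h1
      linarith
    · have h1 := avoidProb_antitone s a x (le_max_left M m)
      have h2 := min_le_left ε (1 - avoidProb s a m y)
      have h3 := hM x hx
      dsimp only at h1
      linarith

/-- **Foster's criterion**: a drift at most `-1` outside a finite set from which `a` is accessible
bounds the mean time until the first visit to `a`. -/
theorem exists_sum_avoidProb_le [Nonempty ι] {V : α → ℝ} (hV : ∀ x, 0 ≤ V x) {C : Set α}
    (hC : C.Finite) {b : ℝ} (hb : 0 ≤ b)
    (hVC : ∀ x ∈ C, (∑ i, V (s x i)) / Fintype.card ι ≤ V x - 1 + b)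
    (hVC' : ∀ x ∉ C, (∑ i, V (s x i)) / Fintype.card ι ≤ V x - 1)
    (ha : ∀ x ∈ C, Relation.TransGen (fun x y => ∃ i, s x i = y) x a) (x : α) :
    ∃ B, ∀ M, ∑ m ∈ Finset.range M, avoidProb s a m x ≤ B := by
  classical
  obtain ⟨M, ε, hε, hM⟩ := exists_uniform_avoidProb_le s a hC ha
  -- The mean hitting time truncated at `M`. Under the killed chain it telescopes: its drift is
  -- `avoidProb s a M x - 1`, which is at most `-ε` on `C` and never positive.
  let u : α → ℝ := fun x => ∑ m ∈ Finset.range M, avoidProb s a m x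
  have hu0 : ∀ x, 0 ≤ u x := fun x => Finset.sum_nonneg fun m _ => avoidProb_nonneg s a m x
  have hu : ∀ x, (∑ i, if s x i = a then 0 else u (s x i)) / Fintype.card ι =
      u x + avoidProb s a M x - 1 := by
    intro x
    have h1 : (∑ i, if s x i = a then 0 else u (s x i)) / Fintype.card ι =
        ∑ m ∈ Finset.range M, avoidProb s a (m + 1) x := by
      simp only [avoidProb]
      rw [← Finset.sum_div, Finset.sum_comm]
      congr 1
      refine Finset.sum_congr rfl fun i _ => ?_
      split_ifs with h <;> simp [u]
    have h2 := Finset.sum_range_succ' (fun m => avoidProb s a m x) M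
    rw [Finset.sum_range_succ] at h2
    rw [h1]
    simp only [avoidProb] at h2 ⊢
    linarith
  have hb' : 0 ≤ b / ε := div_nonneg hb hε.le
  -- The weight `b / ε` makes the drift of `u` on `C` absorb the excess `b` of `V`.
  refine ⟨_, fun M' => sum_avoidProb_le s a (g := fun x => V x + b / ε * u x)
    (fun x => add_nonneg (hV x) (mul_nonneg hb' (hu0 x))) (fun x => ?_) M' x⟩
  have h1 : (∑ i, if s x i = a then 0 else V (s x i) + b / ε * u (s x i)) / Fintype.card ι ≤
      (∑ i, V (s x i)) / Fintype.card ι + b / ε * (u x + avoidProb s a M x - 1) := by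
    rw [← hu x, mul_div_assoc', ← add_div, Finset.mul_sum, ← Finset.sum_add_distrib]
    gcongr with i
    split_ifs
    · simpa using hV _
    · exact le_rfl
  have h2 := avoidProb_le_one s a M x
  by_cases hx : x ∈ C
  · have h3 := hVC x hx
    have h4 : b / ε * (avoidProb s a M x - 1) ≤ b / ε * -ε :=
      mul_le_mul_of_nonneg_left (by linarith [hM x hx]) hb'
    rw [mul_neg, div_mul_cancel₀ _ hε.ne'] at h4
    linarith
  · have h3 := hVC' x hx
    have h4 : b / ε * (avoidProb s a M x - 1) ≤ 0 :=
      mul_nonpos_of_nonneg_of_nonpos hb' (by linarith)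
    linarith

end Foster

theorem summable_avoidProb {n k : ℕ} (hk : 1 ≤ k) (hkn : k < n) (a l : State k) :
    Summable fun m => avoidProb (step (n := n) (k := k)) a m l := by
  have hn : NeZero n := ⟨by omega⟩
  have hn' : (0 : ℝ) < n := Nat.cast_pos.mpr (by omega)
  have hk' : (1 : ℝ) ≤ k := by exact_mod_cast hk
  have hkn' : (k : ℝ) + 1 ≤ n := by exact_mod_cast hkn
  have hdrift (l : State k) : (∑ i : Fin n, (energy k (step l i).1 : ℝ)) / (Fintype.card (Fin n)) =
      energy k l.1 - 2 * (n - k) * total l.1 / n + (k - 1) := by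
    have h := sum_energy_step hk (by omega : k - 1 ≤ n) l
    have h' : (∑ i : Fin n, (energy k (step l i).1 : ℝ)) =
      n * energy k l.1 - 2 * (n - k) * total l.1 + n * (k - 1) := by exact_mod_cast h
    rw [h', Fintype.card_fin]
    field_simp
  have hT (l : State k) : (0 : ℝ) ≤ 2 * (n - k) * total l.1 / n := by
    have : (0 : ℝ) ≤ total l.1 := by exact_mod_cast total_nonneg l.1
    have : (0 : ℝ) ≤ n - k := by linarith
    positivity
  -- The drift never exceeds `k - 1`, whence `b = k`. If the total exceeds `n * k`, the negative
  -- term is at least `k` in size since `n - k ≥ 1`, so the drift is at most `-1`.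
  obtain ⟨B, hB⟩ := exists_sum_avoidProb_le (step (n := n) (k := k)) a
    (V := fun l => (energy k l.1 : ℝ)) (fun l => by exact_mod_cast energy_nonneg l)
    (finite_setOf_total_le k (n * k)) (b := k) (by linarith)
    (fun l _ => by rw [hdrift l]; linarith [hT l])
    (fun l hl => by
      rw [hdrift l]
      have h1 : (n : ℝ) * k < total l.1 := by exact_mod_cast not_le.mp hl
      have h2 : (k : ℝ) ≤ 2 * (n - k) * total l.1 / n := by
        rw [le_div_iff₀ hn']
        have : 0 ≤ (n - k - 1 : ℝ) * total l.1 :=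
          mul_nonneg (by linarith) (by exact_mod_cast total_nonneg l.1)
        nlinarith
      linarith)
    (fun x _ => transGen_leads hk hkn.le x a) l
  exact summable_of_sum_range_le (fun m => avoidProb_nonneg _ a m l) hB

/-! ### The sequence of senders -/

/-- The sequence starting with `x` and continuing with `w`. -/
def seqCons {X : Type*} (x : X) (w : ℕ → X) : ℕ → X
  | 0 => x
  | m + 1 => w m

theorem measurable_seqCons {X : Type*} [MeasurableSpace X] :
    Measurable fun p : X × (ℕ → X) => seqCons p.1 p.2 := by
  refine measurable_pi_lambda _ fun m => ?_
  cases m with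
  | zero => exact measurable_fst
  | succ m => exact (measurable_pi_apply m).comp measurable_snd

theorem map_seqCons {X : Type*} [MeasurableSpace X] (μ : Measure X) [IsProbabilityMeasure μ] :
    (μ.prod (Measure.infinitePi fun _ : ℕ => μ)).map (fun p => seqCons p.1 p.2) =
      Measure.infinitePi fun _ : ℕ => μ := by
  classical
  refine Measure.eq_infinitePi _ fun s t ht => ?_
  obtain ⟨N, hN⟩ : ∃ N, s ⊆ Finset.range (N + 1) :=
    ⟨s.sup id, fun i hi => Finset.mem_range_succ_iff.mpr (Finset.le_sup (f := id) hi)⟩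
  -- Padding with `Set.univ` turns the cylinder into one over an initial segment, where splitting
  -- off coordinate 0 is an index shift.
  let t' : ℕ → Set X := fun i => if i ∈ s then t i else Set.univ
  have ht' : ∀ i, MeasurableSet (t' i) := fun i => by
    dsimp only [t']; split_ifs; exacts [ht i, MeasurableSet.univ]
  have h1 : Set.pi (s : Set ℕ) t = Set.pi (Finset.range (N + 1) : Set ℕ) t' := by
    ext w
    simp only [Set.mem_pi, Finset.mem_coe, t']
    refine ⟨fun h i _ => ?_, fun h i hi => ?_⟩
    · split_ifs with hi
      exacts [h i hi, Set.mem_univ _]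
    · have := h i (hN hi)
      rwa [if_pos hi] at this
  have h2 : ∏ i ∈ s, μ (t i) = ∏ i ∈ Finset.range (N + 1), μ (t' i) := by
    rw [← Finset.prod_subset hN fun i _ hi => by simp [t', hi]]
    exact Finset.prod_congr rfl fun i hi => by simp [t', hi]
  have h3 : (fun p : X × (ℕ → X) => seqCons p.1 p.2) ⁻¹' Set.pi (Finset.range (N + 1) : Set ℕ) t' =
      t' 0 ×ˢ Set.pi (Finset.range N : Set ℕ) fun i => t' (i + 1) := by
    ext ⟨x, w⟩
    simp only [Set.mem_preimage, Set.mem_pi, Finset.mem_coe, Finset.mem_range, Set.mem_prod]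
    refine ⟨fun h => ⟨h 0 (by omega), fun i hi => h (i + 1) (by omega)⟩, fun h i hi => ?_⟩
    cases i with
    | zero => exact h.1
    | succ i => exact h.2 i (by omega)
  rw [h1, h2, Measure.map_apply measurable_seqCons
    (MeasurableSet.pi (Finset.countable_toSet _) fun i _ => ht' i), h3, Measure.prod_prod,
    Measure.infinitePi_pi _ fun i _ => ht' (i + 1), Finset.prod_range_succ', mul_comm]

/-- The law of the sequence of senders. -/
def senderMeasure (n : ℕ) : Measure (ℕ → Fin n) :=
  Measure.infinitePi fun _ : ℕ => uniformOn (Set.univ : Set (Fin n))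

instance {n : ℕ} [NeZero n] : IsProbabilityMeasure (senderMeasure n) := by
  unfold senderMeasure; infer_instance

theorem senderMeasure_apply {n : ℕ} [NeZero n] {A : Set (ℕ → Fin n)} (hA : MeasurableSet A) :
    senderMeasure n A = (∑ i, senderMeasure n (seqCons i ⁻¹' A)) / n := by
  conv_lhs => rw [senderMeasure, ← map_seqCons]
  rw [Measure.map_apply measurable_seqCons hA, Measure.prod_apply (measurable_seqCons hA),
    lintegral_fintype, ENNReal.div_eq_inv_mul, Finset.mul_sum]
  refine Finset.sum_congr rfl fun i _ => ?_
  rw [uniformOn_univ, mul_comm]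
  simp [senderMeasure]
  rfl

/-- The jump chain as a function of the sequence of senders. -/
def senderChain {n k : ℕ} (l : State k) (w : ℕ → Fin n) (m : ℕ) : State k :=
  jumpChain l ((0 : ℕ → ℝ), w) m

theorem senderChain_succ {n k : ℕ} (l : State k) (w : ℕ → Fin n) (m : ℕ) :
    senderChain l w (m + 1) = step (senderChain l w m) (w m) := rfl

theorem jumpChain_eq_senderChain {n k : ℕ} (l : State k) (ω : Path n) (m : ℕ) :
    jumpChain l ω m = senderChain l ω.2 m := by
  induction m with
  | zero => rfl
  | succ m ih => rw [jumpChain, ih]; rfl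

theorem senderChain_seqCons {n k : ℕ} (l : State k) (i : Fin n) (w : ℕ → Fin n) (m : ℕ) :
    senderChain l (seqCons i w) (m + 1) = senderChain (step l i) w m := by
  induction m with
  | zero => rfl
  | succ m ih => rw [senderChain_succ, ih]; rfl

theorem measurable_senderChain {n k : ℕ} (l : State k) (m : ℕ) :
    Measurable fun w : ℕ → Fin n => senderChain l w m := by
  induction m with
  | zero => exact measurable_const
  | succ m ih =>
    have h : Measurable fun p : State k × Fin n => step p.1 p.2 := Measurable.of_discrete
    have h2 : Measurable fun w : ℕ → Fin n => (senderChain l w m, w m) :=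
      ih.prodMk (measurable_pi_apply m)
    simp only [senderChain_succ]
    have h3 := h.comp h2
    rw [Function.comp_def] at h3
    exact h3

/-- The event that the chain started at `l` is not in `a` at any of the times `1, …, m`. -/
def avoidSet {n k : ℕ} (l a : State k) (m : ℕ) : Set (ℕ → Fin n) :=
  {w | ∀ j < m, senderChain l w (j + 1) ≠ a}

theorem measurableSet_avoidSet {n k : ℕ} (l a : State k) (m : ℕ) :
    MeasurableSet (avoidSet (n := n) l a m) := by
  have : avoidSet (n := n) l a m = ⋂ j ∈ Set.Iio m, (fun w => senderChain l w (j + 1)) ⁻¹' {a}ᶜ := by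
    ext w; simp [avoidSet]
  rw [this]
  exact MeasurableSet.biInter (Set.to_countable _) fun j _ =>
    measurable_senderChain l (j + 1) (measurableSet_singleton a).compl

/-- Conditioning on the first sender reproduces the recursion of `avoidProb`. -/
theorem senderMeasure_avoidSet {n k : ℕ} [NeZero n] (l a : State k) (m : ℕ) :
    senderMeasure n (avoidSet l a m) =
      ENNReal.ofReal (avoidProb (step (n := n) (k := k)) a m l) := by
  induction m generalizing l with
  | zero => simp [avoidSet, avoidProb]
  | succ m ih =>
    have hn : (0 : ℝ) < n := Nat.cast_pos.mpr (NeZero.pos n)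
    rw [senderMeasure_apply (measurableSet_avoidSet _ _ _), avoidProb, Fintype.card_fin,
      ENNReal.ofReal_div_of_pos hn, ENNReal.ofReal_natCast, ENNReal.ofReal_sum_of_nonneg fun i _ => by
        split_ifs; exacts [le_rfl, avoidProb_nonneg _ _ _ _]]
    congr 1
    refine Finset.sum_congr rfl fun i _ => ?_
    split_ifs with h
    · rw [ENNReal.ofReal_zero]
      convert measure_empty
      · ext w
        simp only [Set.mem_preimage, Set.mem_empty_iff_false, iff_false]
        exact fun hw => hw 0 (by omega) h
      · infer_instance
    · rw [← ih]
      congr 1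
      ext w
      refine ⟨fun hw j hj => ?_, fun hw j hj => ?_⟩
      · rw [← senderChain_seqCons]
        exact hw (j + 1) (by omega)
      · cases j with
        | zero => exact h
        | succ j =>
          rw [senderChain_seqCons]
          exact hw j (by omega)

/-! ### Positive recurrence -/

theorem lintegral_expMeasure_lt_top {r : ℝ} (hr : 0 < r) :
    ∫⁻ x, ENNReal.ofReal x ∂(expMeasure r) < ∞ := by
  have h1 : Measurable (gammaPDF 1 r) := (measurable_gammaPDFReal 1 r).ennreal_ofReal
  rw [expMeasure, gammaMeasure, lintegral_withDensity_eq_lintegral_mul _ h1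
    ENNReal.measurable_ofReal]
  -- On `x ≥ 0`, x times the Exp(r) density is r⁻¹ times the Gamma(2, r) density.
  calc ∫⁻ x, (gammaPDF 1 r * ENNReal.ofReal) x
      ≤ ∫⁻ x, ENNReal.ofReal r⁻¹ * gammaPDF 2 r x := by
        refine lintegral_mono fun x => ?_
        rw [Pi.mul_apply, gammaPDF, gammaPDF, gammaPDFReal, gammaPDFReal]
        split_ifs with h
        · rw [← ENNReal.ofReal_mul (by positivity), ← ENNReal.ofReal_mul (by positivity)]
          apply le_of_eq
          congr 1
          have h2 : (2 : ℝ) - 1 = 1 := by norm_num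
          rw [h2, Real.Gamma_two, Real.Gamma_one, sub_self, Real.rpow_zero, Real.rpow_one,
            Real.rpow_one, Real.rpow_two]
          field_simp
        · simp
    _ = ENNReal.ofReal r⁻¹ := by
        have h2 : Measurable (gammaPDF 2 r) := (measurable_gammaPDFReal 2 r).ennreal_ofReal
        rw [lintegral_const_mul _ h2,
          lintegral_gammaPDF_eq_one two_pos hr, mul_one]
    _ < ∞ := ENNReal.ofReal_lt_top

theorem ae_pos_expMeasure (r : ℝ) : ∀ᵐ x ∂(expMeasure r), 0 < x := by
  have : expMeasure r (Set.Iic 0) = 0 := by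
    rw [expMeasure, gammaMeasure, withDensity_apply _ measurableSet_Iic,
      ← setLIntegral_congr Iio_ae_eq_Iic]
    exact lintegral_gammaPDF_of_nonpos le_rfl
  rw [ae_iff]
  simpa [Set.Iic] using this

theorem numArrivals_epoch {n : ℕ} {ω : Path n} (hω : ∀ j, 0 < ω.1 j) (m : ℕ) :
    numArrivals ω (epoch ω m) = m := by
  have hmono : StrictMono (epoch ω) := strictMono_nat_of_lt_succ fun j => by
    rw [epoch, epoch, Finset.sum_range_succ]
    linarith [hω j]
  have : {j : ℕ | epoch ω (j + 1) ≤ epoch ω m} = Finset.range m := by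
    ext j
    simp [hmono.le_iff_le]
  rw [numArrivals, this, Set.ncard_coe_finset, Finset.card_range]

/-- If the first return is at arrival `T + 1`, the waiting times `0, …, T` make up its epoch, and
for each `j ≤ T` the path avoids `l` at times `1, …, j`. Hypothesis `hm` only ensures that `T`
exists. -/
theorem returnTime_le {n k : ℕ} (l : State k) {ω : Path n} (hω : ∀ j, 0 < ω.1 j)
    {m : ℕ} (hm : ω.2 ∉ avoidSet l l m) :
    returnTime l ω ≤ ∑' j, (avoidSet l l j).indicator 1 ω.2 * ENNReal.ofReal (ω.1 j) := by
  classical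
  have hex : ∃ j, senderChain l ω.2 (j + 1) = l := by
    simp only [avoidSet, Set.mem_ofPred_eq, not_forall, not_not] at hm
    obtain ⟨j, -, hj⟩ := hm
    exact ⟨j, hj⟩
  let T := Nat.find hex
  have hret : returnTime l ω ≤ ENNReal.ofReal (epoch ω (T + 1)) := by
    refine iInf₂_le _ ⟨?_, ?_⟩
    · exact Finset.sum_le_sum_of_subset_of_nonneg (Finset.range_mono (by omega))
        fun j _ _ => (hω j).le
    · rw [stateProcess, numArrivals_epoch hω, jumpChain_eq_senderChain]
      exact Nat.find_spec hex
  refine hret.trans ?_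
  rw [epoch, ENNReal.ofReal_sum_of_nonneg fun j _ => (hω j).le]
  refine le_trans (le_of_eq ?_) (ENNReal.sum_le_tsum (Finset.range (T + 1)))
  refine Finset.sum_congr rfl fun j hj => ?_
  have hj' : ω.2 ∈ avoidSet l l j := fun i hi =>
    Nat.find_min hex (hi.trans_le (Finset.mem_range_succ_iff.mp hj))
  rw [Set.indicator_of_mem hj', Pi.one_apply, one_mul]

theorem isPositiveRecurrent {n k : ℕ} (hk : 1 ≤ k) (hkn : k < n) {lam : ℝ} (hlam : 0 < lam) :
    IsPositiveRecurrent n k lam := by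
  intro l
  have hn : NeZero n := ⟨by omega⟩
  have hr : 0 < n * lam := mul_pos (Nat.cast_pos.mpr (by omega)) hlam
  have := isProbabilityMeasure_expMeasure hr
  let E : Measure (ℕ → ℝ) := Measure.infinitePi fun _ : ℕ => expMeasure (n * lam)
  have hpath : pathMeasure n lam = E.prod (senderMeasure n) := rfl
  have hsum : ∑' m, senderMeasure n (avoidSet l l m) < ∞ := by
    simp only [senderMeasure_avoidSet]
    rw [← ENNReal.ofReal_tsum_of_nonneg (fun m => avoidProb_nonneg _ _ _ _)
      (summable_avoidProb hk hkn l l)]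
    exact ENNReal.ofReal_lt_top
  have hpos : ∀ᵐ ω ∂(pathMeasure n lam), ∀ j, 0 < ω.1 j := by
    rw [hpath]
    refine ae_all_iff.mpr fun j => ?_
    have h1 : ∀ᵐ x ∂E, 0 < x j :=
      (measurePreserving_eval_infinitePi (fun _ : ℕ => expMeasure (n * lam)) j).quasiMeasurePreserving.ae
        (ae_pos_expMeasure _)
    exact Measure.quasiMeasurePreserving_fst.ae h1
  have hret : ∀ᵐ ω ∂(pathMeasure n lam), ∃ m, ω.2 ∉ avoidSet l l m := by
    rw [hpath]
    refine Measure.quasiMeasurePreserving_snd.ae (p := fun w => ∃ m, w ∉ avoidSet l l m) ?_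
    -- Borel–Cantelli.
    filter_upwards [ae_eventually_notMem hsum.ne] with w hw using hw.exists
  calc ∫⁻ ω, returnTime l ω ∂(pathMeasure n lam)
      ≤ ∫⁻ ω, ∑' j, (avoidSet l l j).indicator 1 ω.2 * ENNReal.ofReal (ω.1 j)
          ∂(pathMeasure n lam) := by
        refine lintegral_mono_ae ?_
        filter_upwards [hpos, hret] with ω h1 ⟨m, hm⟩ using returnTime_le l h1 hm
    _ = ∑' j, ∫⁻ ω, ENNReal.ofReal (ω.1 j) * (avoidSet l l j).indicator 1 ω.2
          ∂(pathMeasure n lam) := by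
        rw [lintegral_tsum fun j => ?_]
        · simp only [mul_comm]
        · refine Measurable.aemeasurable (Measurable.mul ?_ ?_)
          · exact (measurable_one.indicator (measurableSet_avoidSet l l j)).comp measurable_snd
          · exact ((measurable_pi_apply j).comp measurable_fst).ennreal_ofReal
    _ = ∑' j, (∫⁻ x, ENNReal.ofReal x ∂(expMeasure (n * lam))) *
          senderMeasure n (avoidSet l l j) := by
        refine tsum_congr fun j => ?_
        rw [hpath, lintegral_prod_mul (f := fun x : ℕ → ℝ => ENNReal.ofReal (x j))
          (measurable_pi_apply j).ennreal_ofReal.aemeasurable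
          (measurable_one.indicator (measurableSet_avoidSet l l j)).aemeasurable,
          lintegral_indicator_one (measurableSet_avoidSet l l j),
          ← Measure.infinitePi_map_eval (fun _ : ℕ => expMeasure (n * lam)) j,
          lintegral_map ENNReal.measurable_ofReal (measurable_pi_apply j)]
    _ < ∞ := by
        rw [ENNReal.tsum_mul_left]
        exact ENNReal.mul_lt_top (lintegral_expMeasure_lt_top hr) hsum

/-! ### The invariant measure of the jump chain -/

section Push

variable {α ι : Type*} [Fintype ι] [MeasurableSpace α] [DiscreteMeasurableSpace α]

/-- The law after one step of the chain, if the present law is `ν`. -/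
def push (s : α → ι → α) (ν : Measure α) : Measure α :=
  (Fintype.card ι : ℝ≥0∞)⁻¹ • ∑ i, ν.map fun x => s x i

variable (s : α → ι → α) (a : α)

theorem lintegral_push (ν : Measure α) (f : α → ℝ≥0∞) :
    ∫⁻ x, f x ∂(push s ν) = ∫⁻ x, (∑ i, f (s x i)) / Fintype.card ι ∂ν := by
  simp only [push, lintegral_smul_measure, lintegral_finsetSum_measure, smul_eq_mul,
    ENNReal.div_eq_inv_mul]
  rw [lintegral_const_mul _ Measurable.of_discrete,
    lintegral_finsetSum _ fun i _ => Measurable.of_discrete]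
  simp only [lintegral_map (Measurable.of_discrete (f := f)) Measurable.of_discrete]

theorem push_apply (ν : Measure α) (A : Set α) :
    push s ν A = (Fintype.card ι : ℝ≥0∞)⁻¹ * ∑ i, ν ((fun x => s x i) ⁻¹' A) := by
  simp only [push, Measure.smul_apply, Measure.finsetSum_apply, smul_eq_mul]
  simp only [Measure.map_apply (Measurable.of_discrete) (MeasurableSet.of_discrete (s := A))]

theorem push_univ [Nonempty ι] (ν : Measure α) : push s ν Set.univ = ν Set.univ := by
  rw [push_apply]
  simp only [Set.preimage_univ, Finset.sum_const, Finset.card_univ, nsmul_eq_mul]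
  rw [← mul_assoc, ENNReal.inv_mul_cancel (by simp) (by simp), one_mul]

theorem push_sum (ν : ℕ → Measure α) : push s (Measure.sum ν) = Measure.sum fun m => push s (ν m) := by
  ext A hA
  simp only [push_apply, Measure.sum_apply _ hA, Measure.sum_apply _ MeasurableSet.of_discrete,
    ENNReal.tsum_mul_left]
  rw [Summable.tsum_finsetSum fun i _ => ENNReal.summable]

theorem push_smul (c : ℝ≥0∞) (ν : Measure α) : push s (c • ν) = c • push s ν := by
  ext A _
  simp only [push_apply, Measure.smul_apply, smul_eq_mul, Finset.mul_sum]
  exact Finset.sum_congr rfl fun i _ => by ring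

/-- The law at time `m` of the chain started at `a` on the event that it has not returned to `a`. -/
def excursionLaw : ℕ → Measure α
  | 0 => Measure.dirac a
  | m + 1 => (push s (excursionLaw m)).restrict {a}ᶜ

/-- The Markov property at time `m`; for `j = 0` it gives the mass of `excursionLaw s a m`. -/
theorem lintegral_excursionLaw (m j : ℕ) :
    ∫⁻ x, ENNReal.ofReal (avoidProb s a j x) ∂(excursionLaw s a m) =
      ENNReal.ofReal (avoidProb s a (m + j) a) := by
  classical
  induction m generalizing j with
  | zero => rw [excursionLaw, lintegral_dirac, zero_add]
  | succ m ih =>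
    rw [excursionLaw, ← lintegral_indicator MeasurableSet.of_discrete, lintegral_push,
      show m + 1 + j = m + (j + 1) by omega, ← ih]
    refine lintegral_congr fun x => ?_
    rcases isEmpty_or_nonempty ι with h | h
    · simp [avoidProb]
    rw [avoidProb, ENNReal.ofReal_div_of_pos (Nat.cast_pos.mpr Fintype.card_pos),
      ENNReal.ofReal_natCast, ENNReal.ofReal_sum_of_nonneg fun i _ => by
        split_ifs; exacts [le_rfl, avoidProb_nonneg _ _ _ _]]
    congr 1
    refine Finset.sum_congr rfl fun i _ => ?_
    split_ifs with hi <;> simp [hi]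

/-- The expected numbers of visits during an excursion from `a`. -/
def excursionMeasure : Measure α := Measure.sum (excursionLaw s a)

theorem excursionMeasure_univ :
    excursionMeasure s a Set.univ = ∑' m, ENNReal.ofReal (avoidProb s a m a) := by
  rw [excursionMeasure, Measure.sum_apply _ MeasurableSet.univ]
  refine tsum_congr fun m => ?_
  have := lintegral_excursionLaw s a m 0
  simpa [avoidProb] using this

theorem push_excursionMeasure_restrict :
    (push s (excursionMeasure s a)).restrict {a}ᶜ = (excursionMeasure s a).restrict {a}ᶜ := by
  ext A hA
  rw [excursionMeasure, push_sum, Measure.restrict_apply hA, Measure.restrict_apply hA,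
    Measure.sum_apply _ MeasurableSet.of_discrete, Measure.sum_apply _ MeasurableSet.of_discrete,
    tsum_eq_zero_add' (f := fun m => excursionLaw s a m (A ∩ {a}ᶜ)) ENNReal.summable]
  have h0 : excursionLaw s a 0 (A ∩ {a}ᶜ) = 0 := by
    simp [excursionLaw]
  rw [h0, zero_add]
  refine tsum_congr fun m => ?_
  rw [excursionLaw, Measure.restrict_apply MeasurableSet.of_discrete, Set.inter_assoc,
    Set.inter_self]

/-- Off `a`, a step only shifts the index of the excursion laws. The mass at `a` then agrees because
the total mass is preserved and finite, so that it can be cancelled. -/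
theorem push_excursionMeasure [Nonempty ι] (h : excursionMeasure s a Set.univ ≠ ∞) :
    push s (excursionMeasure s a) = excursionMeasure s a := by
  set μ := excursionMeasure s a with hμ
  have h1 : IsFiniteMeasure μ := ⟨h.lt_top⟩
  have h2 : IsFiniteMeasure (push s μ) := ⟨by rw [push_univ]; exact h.lt_top⟩
  have hc : push s μ {a}ᶜ = μ {a}ᶜ := by
    have := congrArg (fun ν => ν Set.univ) (push_excursionMeasure_restrict s a)
    simpa [← hμ] using this
  have ha : (push s μ).restrict {a} = μ.restrict {a} := by
    have h3 := measure_add_measure_compl (μ := push s μ) (MeasurableSet.of_discrete (s := {a}))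
    have h4 := measure_add_measure_compl (μ := μ) (MeasurableSet.of_discrete (s := {a}))
    rw [hc, push_univ, ← h4] at h3
    rw [Measure.restrict_singleton, Measure.restrict_singleton,
      (ENNReal.add_left_inj (measure_ne_top μ _)).mp h3]
  rw [← Measure.restrict_add_restrict_compl (μ := push s μ) (MeasurableSet.of_discrete (s := {a})),
    ha, hμ, push_excursionMeasure_restrict,
    Measure.restrict_add_restrict_compl MeasurableSet.of_discrete]

theorem exists_push_eq [Nonempty ι] (h : Summable fun m => avoidProb s a m a) :
    ∃ π : Measure α, IsProbabilityMeasure π ∧ push s π = π := by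
  have h1 : excursionMeasure s a Set.univ ≠ ∞ := by
    rw [excursionMeasure_univ, ← ENNReal.ofReal_tsum_of_nonneg
      (fun m => avoidProb_nonneg _ _ _ _) h]
    exact ENNReal.ofReal_ne_top
  have h2 : excursionMeasure s a Set.univ ≠ 0 := by
    rw [excursionMeasure_univ]
    intro h0
    have := ENNReal.tsum_eq_zero.mp h0 0
    simp [avoidProb] at this
  refine ⟨(excursionMeasure s a Set.univ)⁻¹ • excursionMeasure s a, ⟨?_⟩, ?_⟩
  · rw [Measure.smul_apply, smul_eq_mul, ENNReal.inv_mul_cancel h2 h1]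
  · rw [push_smul, push_excursionMeasure s a h1]

end Push

/-! ### Stability -/

theorem lintegral_senderMeasure_preimage {n k : ℕ} [NeZero n] {π : Measure (State k)}
    (hπ : push (step (n := n) (k := k)) π = π) (m : ℕ) (A : Set (State k)) :
    ∫⁻ l, senderMeasure n ((fun w => senderChain l w m) ⁻¹' A) ∂π = π A := by
  induction m with
  | zero =>
    rw [← lintegral_indicator_one MeasurableSet.of_discrete]
    refine lintegral_congr fun l => ?_
    by_cases hl : l ∈ A <;> simp [senderChain, jumpChain, hl]
  | succ m ih =>
    rw [← ih]
    conv_rhs => rw [← hπ, lintegral_push]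
    refine lintegral_congr fun l => ?_
    rw [senderMeasure_apply (measurable_senderChain l (m + 1) MeasurableSet.of_discrete),
      Fintype.card_fin]
    simp only [Set.preimage_preimage, senderChain_seqCons]

theorem measurable_numArrivals {n : ℕ} (t : ℝ) :
    Measurable fun ω : Path n => numArrivals ω t := by
  have h : Measurable fun ω : Path n => {m : ℕ | epoch ω (m + 1) ≤ t} := by
    refine measurable_set_iff.mpr fun m => measurableSet_setOfPred.mp ?_
    have hm : Measurable fun ω : Path n => epoch ω (m + 1) :=
      Finset.measurable_sum _ fun j _ => (measurable_pi_apply j).comp measurable_fst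
    exact measurableSet_le hm measurable_const
  exact measurable_ncard.comp h

theorem stateProcess_eq {n k : ℕ} (l : State k) (t : ℝ) (ω : Path n) :
    stateProcess l t ω = senderChain l ω.2 (numArrivals ω t) :=
  jumpChain_eq_senderChain l ω _

theorem measurable_stateProcess {n k : ℕ} (t : ℝ) :
    Measurable fun p : State k × Path n => stateProcess p.1 t p.2 := by
  refine measurable_from_prod_countable_right fun l => ?_
  have h : Measurable fun q : ℕ × (ℕ → Fin n) => senderChain l q.2 q.1 :=
    measurable_from_prod_countable_right fun m => measurable_senderChain l m
  have h2 := h.comp ((measurable_numArrivals t).prodMk measurable_snd)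
  rw [Function.comp_def] at h2
  simpa only [stateProcess_eq] using h2

/-- For fixed arrival times the state is the chain at a deterministic index, and its law is `π`
whatever that index. So the law of `numArrivals` plays no role, nor does its default value 0 when
infinitely many epochs precede `t`. -/
theorem isInvariant_of_push_eq {n k : ℕ} [NeZero n] {lam : ℝ} (hlam : 0 < lam)
    {π : Measure (State k)} [IsProbabilityMeasure π]
    (hπ : push (step (n := n) (k := k)) π = π) : IsInvariant n k lam π := by
  intro t _
  have hr : 0 < n * lam := mul_pos (Nat.cast_pos.mpr (NeZero.pos n)) hlam
  have := isProbabilityMeasure_expMeasure hr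
  let E : Measure (ℕ → ℝ) := Measure.infinitePi fun _ : ℕ => expMeasure (n * lam)
  have hpath : pathMeasure n lam = E.prod (senderMeasure n) := rfl
  have hE : IsProbabilityMeasure E := by dsimp only [E]; infer_instance
  ext A hA
  have hmeas : MeasurableSet ((fun p : State k × Path n => stateProcess p.1 t p.2) ⁻¹' A) :=
    measurable_stateProcess t hA
  rw [hpath, Measure.map_apply (measurable_stateProcess t) hA, Measure.prod_apply hmeas]
  have h1 (l : State k) : MeasurableSet (stateProcess (n := n) l t ⁻¹' A) :=
    measurable_prodMk_left hmeas
  -- The count depends on the times only, so a dummy sender sequence can replace `w`.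
  have h2 (l : State k) (u : ℕ → ℝ) (w : ℕ → Fin n) :
      stateProcess l t (u, w) = senderChain l w (numArrivals (n := n) (u, fun _ => 0) t) :=
    stateProcess_eq l t (u, w)
  calc _ = ∫⁻ l, ∫⁻ u, senderMeasure n ((fun w => senderChain l w
          (numArrivals (n := n) (u, fun _ => 0) t)) ⁻¹' A) ∂E ∂π := by
        refine lintegral_congr fun l => ?_
        refine (Measure.prod_apply (h1 l)).trans ?_
        refine lintegral_congr fun u => ?_
        congr 1
        ext w
        simp only [Set.mem_preimage, h2]
    _ = ∫⁻ u, ∫⁻ l, senderMeasure n ((fun w => senderChain l w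
          (numArrivals (n := n) (u, fun _ => 0) t)) ⁻¹' A) ∂π ∂E := by
        refine lintegral_lintegral_swap (Measurable.aemeasurable ?_)
        refine measurable_from_prod_countable_right fun l => ?_
        have h3 : Measurable fun m => senderMeasure n ((fun w => senderChain l w m) ⁻¹' A) :=
          Measurable.of_discrete
        exact h3.comp ((measurable_numArrivals (n := n) t).comp measurable_prodMk_right)
    _ = π A := by
        simp only [lintegral_senderMeasure_preimage hπ, lintegral_const, measure_univ, mul_one]


end BatchMix

end

theorem theorem2 (n k : ℕ) (hk : 2 ≤ k) (hkn : k < n) (lam : ℝ) (hlam : 0 < lam) :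
    BatchMix.IsStable n k lam ∧ BatchMix.IsPositiveRecurrent n k lam := by
  have hn : NeZero n := ⟨by omega⟩
  have hk' : 1 ≤ k := by omega
  obtain ⟨π, h1, h2⟩ := BatchMix.exists_push_eq (BatchMix.step (n := n) (k := k))
    (BatchMix.emptyState k) (BatchMix.summable_avoidProb hk' hkn _ _)
  exact ⟨⟨π, h1, BatchMix.isInvariant_of_push_eq hlam h2⟩,
    BatchMix.isPositiveRecurrent hk' hkn hlam⟩
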